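/- Let $J$ be a finite set with $m=|J|$ elements and let $(J,h)$ be an integer polymatroid, i.e. $h:2^J\to\mathbb N_0$ satisfies $h(\emptyset)=0$, is monotone increasing, and satisfies $h(X\cap Y)+h(X\cup Y)\le h(X)+h(Y)$ for all $X,Y\subseteq J$. Assume that it is uniform: $h(X)=h_{|X|}$ depends only on $|X|$. Put $g_i=h_{i+1}-h_i$ for $0\le i<m$ and $g_m=0$, and assume $\eta(g):=\min\{i\in\{0,\dots,m\}: g_i=0\}=2$, i.e. $m\ge 2$ and $g_0\ge g_1>g_2=0$. Let $P$ be a finite set of participants with a partition $\Pi=(P_x)_{x\in J}$ into nonempty blocks such that $h(\{x\})\le |P_x|$ for all $x\in J$. Let $\Delta\subseteq 2^J\setminus\{\emptyset\}$ be a monotone increasing family compatible with $(J,h)$: for $x_0\notin J$, the function $h'$ on $2^{J\cup\{x_0\}}$ given, for $X\subseteq J$, by $h'(X)=h(X)$, by $h'(X\cup\{x_0\})=h(X)$ if $X\in\Delta$, and by $h'(X\cup\{x_0\})=h(X)+1$ if $X\notin\Delta$, is monotone increasing and submodular. For $X\subseteq J$ let $\mathcal B(X)$ be the set of all $v\in\mathbb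 N_0^J$ with support contained in $X$, $\sum_{x\in J}v_x=h(X)$, and $\sum_{x\in Y}v_x\le h(Y)$ for all $Y\subseteq X$. Let $\Gamma=\Gamma(\Pi,(J,h),\Delta)$ be the family of all $A\subseteq P$ such that the vector $\pi(A)=(|A\cap P_x|)_{x\in J}$ satisfies $\pi(A)\ge w$ (coordinatewise) for some minimal element $w$ of $\bigcup_{X\in\Delta}\mathcal B(X)$. Then $\Gamma$ is an ideal access structure: there is a secret sharing scheme, consisting of a random secret and a random share for each $p\in P$ on a common finite probability space, with finite sets $S_0$ of possible secrets, $|S_0|\ge 2$, and $S_p$ of possible shares of $p$ (all elements being taken with positive probability), such that the shares of the participants in $A$ determine the secret if $A\in\Gamma$, the tuple of these shares is independent of the secret if $A\notin\Gamma$, and $|S_p|=|S_0|$ for all $p\in P$. -/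

import Mathlib

/-! ### Integer polymatroids -/

/-- `h` is the rank function of an integer polymatroid with ground set `J`. -/
structure IsPolymatroid {J : Type*} [DecidableEq J] (h : Finset J → ℕ) : Prop where
  map_empty : h ∅ = 0
  mono : ∀ X Y : Finset J, X ⊆ Y → h X ≤ h Y
  submodular : ∀ X Y : Finset J, h (X ∩ Y) + h (X ∪ Y) ≤ h X + h Y

/-- A rank function is uniform if it depends only on the cardinality. -/
def IsUniform {J : Type*} (h : Finset J → ℕ) : Prop :=
  ∀ X Y : Finset J, X.card = Y.card → h X = h Y

/-- The number `h_i`: the common value of a uniform rank function `h` on the sets with `i`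
elements (written as the maximum of `h` over these sets; see `rankSeq_card`). -/
def rankSeq {J : Type*} [Fintype J] (h : Finset J → ℕ) (i : ℕ) : ℕ :=
  (Finset.univ.powersetCard i).sup h

theorem rankSeq_card {J : Type*} [Fintype J] {h : Finset J → ℕ} (hu : IsUniform h)
    (X : Finset J) : rankSeq h X.card = h X := by
  apply le_antisymm
  · refine Finset.sup_le fun Y hY => ?_
    rw [hu Y X (Finset.mem_powersetCard.1 hY).2]
  · exact Finset.le_sup (f := h) (Finset.mem_powersetCard.2 ⟨Finset.subset_univ X, rfl⟩)

/-- The increment sequence: `g_i = h_{i+1} - h_i` for `i < m` and `g_m = 0`, where `m = |J|`. -/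
def increment {J : Type*} [Fintype J] (h : Finset J → ℕ) (i : ℕ) : ℕ :=
  if i < Fintype.card J then rankSeq h (i + 1) - rankSeq h i else 0

/-- `η(g) = min {i ∈ {0, …, m} : g_i = 0}`. -/
noncomputable def eta {J : Type*} [Fintype J] (h : Finset J → ℕ) : ℕ :=
  sInf {i : ℕ | i ≤ Fintype.card J ∧ increment h i = 0}

open Classical in
/-- The function `h'` on the subsets of `J ∪ {x₀}`, where `J ∪ {x₀}` is `Option J` and
`x₀ = none`: for `X ⊆ J`, `h' X = h X`, and `h' (X ∪ {x₀})` is `h X` if `X ∈ Δ` and `h X + 1`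
otherwise. -/
noncomputable def extensionRank {J : Type*} (h : Finset J → ℕ) (Δ : Set (Finset J))
    (Y : Finset (Option J)) : ℕ :=
  if none ∈ Y ∧ Finset.eraseNone Y ∉ Δ then h (Finset.eraseNone Y) + 1
  else h (Finset.eraseNone Y)

/-- `Δ` is compatible with `(J, h)`: `h'` is monotone increasing and submodular. -/
def Compatible {J : Type*} [DecidableEq J] (h : Finset J → ℕ) (Δ : Set (Finset J)) : Prop :=
  (∀ X Y : Finset (Option J), X ⊆ Y → extensionRank h Δ X ≤ extensionRank h Δ Y) ∧
  (∀ X Y : Finset (Option J),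
    extensionRank h Δ (X ∩ Y) + extensionRank h Δ (X ∪ Y) ≤
      extensionRank h Δ X + extensionRank h Δ Y)

/-- The set `𝓑((J, h), X)` of vectors `v ∈ ℕ^J` with support in `X`, `|v| = h X`, and
`|v_Y| ≤ h Y` for all `Y ⊆ X`. -/
def bases {J : Type*} [Fintype J] (h : Finset J → ℕ) (X : Finset J) : Set (J → ℕ) :=
  {v | (∀ x, v x ≠ 0 → x ∈ X) ∧ ∑ x, v x = h X ∧ ∀ Y ⊆ X, ∑ x ∈ Y, v x ≤ h Y}

/-! ### Multipartite access structures -/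

/-- `Π = (P_x)_{x ∈ J}` is a partition of the set of participants into nonempty blocks. -/
structure IsPartition {J P : Type*} (Pi : J → Finset P) : Prop where
  nonempty : ∀ x, (Pi x).Nonempty
  disjoint : ∀ x y, x ≠ y → Disjoint (Pi x) (Pi y)
  cover : ∀ p, ∃ x, p ∈ Pi x

/-- The vector `π(A) = (|A ∩ P_x|)_{x ∈ J}`. -/
def blockVector {J P : Type*} [DecidableEq P] (Pi : J → Finset P) (A : Finset P) : J → ℕ :=
  fun x => (A ∩ Pi x).card

/-- The vector form of the access structure determined by `Π`, `(J, h)` and `Δ`: the smallest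
monotone increasing subset of `{v : v ≤ π(P)}` that contains the minimal elements of
`⋃_{X ∈ Δ} 𝓑((J, h), X)`. -/
def vectorStructure {J P : Type*} [Fintype J] [Fintype P] [DecidableEq P] (Pi : J → Finset P)
    (h : Finset J → ℕ) (Δ : Set (Finset J)) : Set (J → ℕ) :=
  {v | v ≤ blockVector Pi Finset.univ ∧
    ∃ w, Minimal (fun u => u ∈ ⋃ X ∈ Δ, bases h X) w ∧ w ≤ v}

/-- The access structure `Γ(Π, (J, h), Δ)`, as a family of sets of participants. -/
def accessStructure {J P : Type*} [Fintype J] [Fintype P] [DecidableEq P] (Pi : J → Finset P)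
    (h : Finset J → ℕ) (Δ : Set (Finset J)) : Set (Finset P) :=
  {A | blockVector Pi A ∈ vectorStructure Pi h Δ}

/-! ### Secret sharing schemes -/

/-- A secret sharing scheme with set of participants `P`: on a finite probability space (the
random choices of the dealer), a random secret and a random share for every participant. `Secret`
and `Share p` are the sets of all possible secrets and of all possible shares of `p`, i.e. every
element is taken with positive probability. There are at least two possible secrets. -/
structure SecretSharingScheme (P : Type*) where
  Ω : Type
  Secret : Type
  Share : P → Type
  finite_Ω : Finite Ω
  finite_Secret : Finite Secret
  finite_Share : ∀ p, Finite (Share p)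
  nontrivial_Secret : Nontrivial Secret
  law : PMF Ω
  secret : Ω → Secret
  share : ∀ p, Ω → Share p
  secret_possible : ∀ s, ∃ ω ∈ law.support, secret ω = s
  share_possible : ∀ p, ∀ a : Share p, ∃ ω ∈ law.support, share p ω = a

namespace SecretSharingScheme

variable {P : Type*}

/-- The shares of the participants in `A` determine the secret. -/
def Recovers (S : SecretSharingScheme P) (A : Finset P) : Prop :=
  ∀ ω ∈ S.law.support, ∀ ω' ∈ S.law.support,
    (∀ p ∈ A, S.share p ω = S.share p ω') → S.secret ω = S.secret ω'

/-- The shares of the participants in `A` give no information about the secret: the secret and the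
tuple of these shares are independent random variables. -/
def NoInformation (S : SecretSharingScheme P) (A : Finset P) : Prop :=
  ∀ (s : S.Secret) (a : ∀ p, S.Share p),
    S.law.toOuterMeasure {ω | S.secret ω = s ∧ ∀ p ∈ A, S.share p ω = a p} =
      S.law.toOuterMeasure {ω | S.secret ω = s} *
        S.law.toOuterMeasure {ω | ∀ p ∈ A, S.share p ω = a p}

/-- `S` is a perfect secret sharing scheme whose family of authorized sets is `Γ`. -/
def IsPerfect (S : SecretSharingScheme P) (Γ : Set (Finset P)) : Prop :=
  (∀ A ∈ Γ, S.Recovers A) ∧ (∀ A ∉ Γ, S.NoInformation A)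

end SecretSharingScheme

/-- `Γ` is ideal: it is the access structure of a perfect secret sharing scheme in which, for every
participant, there are exactly as many possible shares as possible secrets. -/
def IsIdealAccessStructure {P : Type*} (Γ : Set (Finset P)) : Prop :=
  ∃ S : SecretSharingScheme P, S.IsPerfect Γ ∧ ∀ p, Nat.card (S.Share p) = Nat.card S.Secret

/-! Uniformity and η = 2 force the ranks 0, a, a + b, a + b, … with 1 ≤ b ≤ a. For nonempty Δ, a set
A is therefore authorized iff it has at least a members in some block x with {x} ∈ Δ, or its block
sizes, truncated at a, add up to at least a + b (`mem_accessStructure_iff_of_rank`).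

This condition is realized linearly. In a space E of dimension a + b over a large prime field there
are subspaces V x of dimension a, any two spanning E, and a vector e ≠ 0 that lies in V x exactly
when {x} ∈ Δ (`exists_subspaces_sup_eq_top`). Two of the V x meet in dimension a - b, so e can lie
in several of them only if b < a; compatibility of Δ guarantees this (`Compatible.rank_pair_lt`).

Each participant of block x receives a generic vector of V x (`exists_generalPosition`). A proper
subspace spanned by such vectors contains at most one V x, which determines its dimension and
confines e to that V x (`exists_finrank_span_eq`). Counting dimensions, e lies in the span of the
vectors of A iff A is authorized (`mem_span_iff_of_generalPosition`). A random linear functional,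
evaluated at e and at the participants' vectors, is then the scheme (`isIdeal_of_vectors`). -/

/-! ### Ideal schemes from vector configurations -/

/-- If a set of functionals is invariant under adding multiples of `d`, and `d e ≠ 0`, then the fibres
of evaluation at `e` on it all have the same size. -/
theorem card_dual_fiber {K E : Type} [Field K] [Fintype K] [AddCommGroup E] [Module K E]
    [Finite (Module.Dual K E)] (e : E) (d : Module.Dual K E) (hd : d e ≠ 0)
    (C : Set (Module.Dual K E)) (hC : ∀ f ∈ C, ∀ c : K, f + c • d ∈ C) (s : K) :
    Nat.card {f | f e = s ∧ f ∈ C} * Fintype.card K = Nat.card C := by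
  rw [← Nat.card_eq_fintype_card, ← Nat.card_prod]
  refine Nat.card_congr ⟨fun x => ⟨x.1.1 + x.2 • d, hC _ x.1.2.2 _⟩,
    fun f => (⟨f.1 + ((s - f.1 e) / d e) • d, ?_, hC _ f.2 _⟩, (f.1 e - s) / d e), ?_, ?_⟩
  · simp [hd]
  · rintro ⟨⟨f, hf, hfC⟩, c⟩
    subst hf
    ext
    · simp [neg_div, mul_div_cancel_right₀ _ hd]
    · simp [hd]
  · rintro ⟨f, hf⟩
    ext x
    simp
    ring

/-- A configuration of nonzero vectors over a finite field yields an ideal secret sharing scheme: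
the dealer picks a linear functional uniformly at random and hands out its values. -/
theorem isIdeal_of_vectors {K E : Type} [Field K] [Finite K] [AddCommGroup E] [Module K E]
    [Module.Finite K E] {P : Type*} {Γ : Set (Finset P)} (e : E) (u : P → E) (he : e ≠ 0)
    (hu : ∀ p, u p ≠ 0)
    (hΓ : ∀ A : Finset P, A ∈ Γ ↔ e ∈ Submodule.span K (u '' A)) :
    IsIdealAccessStructure Γ := by
  classical
  have : Fintype K := Fintype.ofFinite K
  have : Finite (Module.Dual K E) := Module.finite_of_finite K
  have : Fintype (Module.Dual K E) := Fintype.ofFinite _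
  have surj : ∀ v : E, v ≠ 0 → ∀ s : K, ∃ f : Module.Dual K E, f v = s := by
    intro v hv s
    obtain ⟨f, hf, -⟩ := Submodule.exists_le_ker_of_notMem (K := K) (p := ⊥) (v := v) (by simpa)
    exact ⟨(s / f v) • f, by simp [hf]⟩
  refine ⟨{ Ω := Module.Dual K E, Secret := K, Share := fun _ => K
            finite_Ω := inferInstance
            finite_Secret := inferInstance
            finite_Share := fun _ => inferInstance
            nontrivial_Secret := inferInstance
            law := PMF.uniformOfFintype _
            secret := fun f => f e
            share := fun p f => f (u p)
            secret_possible := fun s => by simpa using surj e he s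
            share_possible := fun p s => by simpa using surj (u p) (hu p) s },
    ⟨fun A hA => ?_, fun A hA => ?_⟩, fun _ => rfl⟩
  · intro f _ g _ hfg
    have hker : Submodule.span K (u '' A) ≤ LinearMap.eqLocus f g := by
      rw [Submodule.span_le]
      rintro _ ⟨p, hp, rfl⟩
      exact hfg p hp
    exact hker ((hΓ A).1 hA)
  · intro s a
    -- Adding multiples of `d` changes no share of A but moves the secret through all of K, so each
    -- secret has conditional probability 1/|K|, which is also its unconditional one.
    obtain ⟨d, hd, hker⟩ := Submodule.exists_le_ker_of_notMem (mt (hΓ A).2 hA)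
    have hdu : ∀ p ∈ A, d (u p) = 0 := fun p hp =>
      hker (Submodule.subset_span ⟨p, hp, rfl⟩)
    have h₁ := card_dual_fiber e d hd {f | ∀ p ∈ A, f (u p) = a p}
      (fun f hf c p hp => by simp [hdu p hp, hf p hp]) s
    have h₂ := card_dual_fiber e d hd Set.univ (fun _ _ _ => trivial) s
    simp only [Set.mem_univ, and_true, Set.mem_ofPred_eq, Nat.card_univ] at h₁ h₂
    dsimp only
    simp only [PMF.toOuterMeasure_uniformOfFintype_apply, ← Nat.card_eq_fintype_card]
    rw [← Nat.card_eq_fintype_card] at h₁ h₂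
    have hΩ : Nat.card (Module.Dual K E) ≠ 0 := Nat.card_pos.ne'
    have hK : Nat.card K ≠ 0 := Nat.card_pos.ne'
    rw [← ENNReal.toReal_eq_toReal_iff' (by finiteness) (by finiteness)]
    simp only [ENNReal.toReal_div, ENNReal.toReal_mul, ENNReal.toReal_natCast]
    rw [← h₁, ← h₂] at *
    push_cast
    field_simp

/-! ### Vectors in general position -/

/-- A subspace that is contained in none of fewer than `|K|` given subspaces is not covered by
their union. -/
theorem exists_mem_forall_notMem {K E ι : Type*} [Field K] [Fintype K] [AddCommGroup E]
    [Module K E] (V : Submodule K E) (s : Finset ι) (W : ι → Submodule K E)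
    (hs : s.card < Fintype.card K) (hW : ∀ i ∈ s, ¬ V ≤ W i) :
    ∃ u ∈ V, ∀ i ∈ s, u ∉ W i := by
  classical
  induction s using Finset.induction_on with
  | empty => exact ⟨0, V.zero_mem, by simp⟩
  | insert j s hj ih =>
    rw [Finset.card_insert_of_notMem hj] at hs
    obtain ⟨u, huV, hu⟩ := ih (by omega) fun i hi => hW i (Finset.mem_insert_of_mem hi)
    by_cases huj : u ∈ W j
    swap
    · exact ⟨u, huV, by simpa [huj] using hu⟩
    obtain ⟨w, hwV, hw⟩ := SetLike.not_le_iff_exists.1 (hW j (Finset.mem_insert_self _ _))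
    -- The line w + K u misses `W j`, since u lies in `W j` and w does not, and it meets every other
    -- `W i` at most once, since u is not in `W i`. Fewer than |K| values of c are thus bad.
    have huniq : ∀ i ∈ s, ∃ c₀ : K, ∀ c : K, w + c • u ∈ W i → c = c₀ := by
      intro i hi
      by_cases hex : ∃ c₀ : K, w + c₀ • u ∈ W i
      · obtain ⟨c₀, hc₀⟩ := hex
        refine ⟨c₀, fun c hc => by_contra fun hne => hu i hi ?_⟩
        have := (W i).sub_mem hc hc₀
        rw [add_sub_add_left_eq_sub, ← sub_smul] at this
        exact ((W i).smul_mem_iff (sub_ne_zero.2 hne)).1 this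
      · exact ⟨0, fun c hc => (hex ⟨c, hc⟩).elim⟩
    choose! c₀ hc₀ using huniq
    obtain ⟨c, -, hc⟩ := Finset.exists_mem_notMem_of_card_lt_card (s := s.image c₀)
      (t := Finset.univ) (by have := Finset.card_image_le (s := s) (f := c₀); simp; omega)
    refine ⟨w + c • u, V.add_mem hwV (V.smul_mem _ huV), fun i hi hmem => ?_⟩
    rcases Finset.mem_insert.1 hi with rfl | hi
    · exact hw (((W i).add_mem_iff_left ((W i).smul_mem _ huj)).1 hmem)
    · exact hc (Finset.mem_image.2 ⟨i, hi, (hc₀ i hi c hmem).symm⟩)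

/-- Vectors `u p ∈ V p` can be chosen in general position with respect to each other and to a
given finite family of subspaces. -/
theorem exists_generalPosition {K E ι P : Type*} [Field K] [Fintype K] [AddCommGroup E]
    [Module K E] [Module.Finite K E] [Fintype ι] [Fintype P] (V : P → Submodule K E)
    (T : ι → Submodule K E) (hcard : Fintype.card ι * 2 ^ Fintype.card P < Fintype.card K) :
    ∃ u : P → E, (∀ p, u p ∈ V p) ∧ ∀ (A : Finset P) (i : ι),
      (∀ p ∈ A, ¬ V p ≤ T i ⊔ Submodule.span K (u '' A)) →
        Module.finrank K ↥(T i ⊔ Submodule.span K (u '' A)) =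
          Module.finrank K (T i) + A.card := by
  classical
  suffices ∀ Q : Finset P, ∃ u : P → E, (∀ p, u p ∈ V p) ∧ ∀ A ⊆ Q, ∀ i : ι,
      (∀ p ∈ A, ¬ V p ≤ T i ⊔ Submodule.span K (u '' A)) →
        Module.finrank K ↥(T i ⊔ Submodule.span K (u '' A)) =
          Module.finrank K (T i) + A.card by
    obtain ⟨u, huV, hu⟩ := this Finset.univ
    exact ⟨u, huV, fun A => hu A (Finset.subset_univ A)⟩
  intro Q
  induction Q using Finset.induction_on with
  | empty =>
    refine ⟨0, fun p => (V p).zero_mem, fun A hA i _ => ?_⟩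
    obtain rfl := Finset.subset_empty.1 hA
    rw [Finset.coe_empty, Set.image_empty, Submodule.span_empty, sup_bot_eq, Finset.card_empty,
      add_zero]
  | insert p Q hp ih =>
    obtain ⟨u, huV, hu⟩ := ih
    let W : ι × Finset P → Submodule K E := fun x => T x.1 ⊔ Submodule.span K (u '' x.2)
    -- All subsets of P are used at once, whence the bound `hcard`; only the spans that do not
    -- contain `V p` can be avoided.
    obtain ⟨v, hvV, hv⟩ := exists_mem_forall_notMem (V p)
      (Finset.univ.filter fun x => ¬ V p ≤ W x) W
      (lt_of_le_of_lt (Finset.card_filter_le _ _) (by simpa using hcard)) (by simp)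
    have himage : ∀ B ⊆ Q, Function.update u p v '' B = u '' B := fun B hB =>
      Set.image_congr fun q hq => Function.update_of_ne (fun h : q = p => hp (h ▸ hB hq)) _ _
    refine ⟨Function.update u p v, fun q => ?_, fun A hA i hAi => ?_⟩
    · by_cases hq : q = p
      · subst hq; simpa using hvV
      · simpa [hq] using huV q
    by_cases hpA : p ∈ A
    · obtain ⟨B, hpB, rfl⟩ : ∃ B, p ∉ B ∧ A = insert p B :=
        ⟨A.erase p, by simp, (Finset.insert_erase hpA).symm⟩
      have hBQ : B ⊆ Q := (Finset.insert_subset_insert_iff hpB).1 hA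
      have hspan : T i ⊔ Submodule.span K (Function.update u p v '' ↑(insert p B)) =
          W (i, B) ⊔ Submodule.span K {v} := by
        rw [Finset.coe_insert, Set.image_insert_eq, himage B hBQ, Function.update_self,
          Submodule.span_insert, sup_comm (Submodule.span K {v}), sup_assoc]
      rw [hspan] at hAi ⊢
      have hvW : v ∉ W (i, B) := hv _ (by
        simpa using fun h => hAi p hpA (h.trans le_sup_left))
      rw [Submodule.finrank_sup_span_singleton hvW, hu B hBQ i fun q hq h =>
        hAi q (Finset.mem_insert_of_mem hq) (h.trans le_sup_left),
        Finset.card_insert_of_notMem hpB, add_assoc]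
    · have hAQ : A ⊆ Q := (Finset.subset_insert_iff_of_notMem hpA).1 hA
      rw [himage A hAQ] at hAi ⊢
      exact hu A hAQ i hAi

/-! ### The access structure in terms of block sizes -/

/-- A uniform polymatroid with `η = 2` has the ranks `0, a, a + b, a + b, …` with
`1 ≤ b ≤ a`. -/
theorem exists_rank_of_eta_eq_two {J : Type*} [Fintype J] [DecidableEq J] {h : Finset J → ℕ}
    (hpoly : IsPolymatroid h) (hunif : IsUniform h) (heta : eta h = 2) :
    2 ≤ Fintype.card J ∧ ∃ a b, 1 ≤ b ∧ b ≤ a ∧ (∀ x, h {x} = a) ∧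
      ∀ X : Finset J, 2 ≤ X.card → h X = a + b := by
  -- The infimum is attained because the convention g_m = 0 makes the set nonempty.
  have hmem : 2 ∈ {i : ℕ | i ≤ Fintype.card J ∧ increment h i = 0} :=
    heta ▸ Nat.sInf_mem ⟨Fintype.card J, le_rfl, by simp [increment]⟩
  have hmin : ∀ i < 2, ¬ (i ≤ Fintype.card J ∧ increment h i = 0) := fun i hi =>
    Nat.notMem_of_lt_sInf (s := {i : ℕ | i ≤ Fintype.card J ∧ increment h i = 0})
      (lt_of_lt_of_eq hi heta.symm)
  obtain ⟨hm, hinc⟩ := hmem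
  obtain ⟨x, y, hxy⟩ := Fintype.exists_pair_of_one_lt_card (α := J) (by omega)
  have hr : ∀ X : Finset J, rankSeq h X.card = h X := rankSeq_card hunif
  have hr₁ : rankSeq h 1 = h {x} := by simpa using hr {x}
  have hr₂ : rankSeq h 2 = h {x, y} := by simpa [hxy] using hr {x, y}
  have h₁ : h {x} < h {x, y} := by
    have := hmin 1 (by omega)
    simp only [increment, if_pos (show 1 < Fintype.card J by omega), Nat.reduceAdd] at this
    omega
  have hone : ∀ z, h {z} = h {x} := fun z => hunif _ _ (by simp)
  have htwo : ∀ X : Finset J, X.card = 2 → h X = h {x, y} := fun X hX =>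
    hunif _ _ (by simp [hxy, hX])
  have hthree : ∀ X : Finset J, X.card = 3 → h X ≤ h {x, y} := by
    intro X hX
    have hX' : 2 < Fintype.card J := by
      have := X.card_le_univ
      omega
    have h3 := hr X
    rw [hX] at h3
    simp only [increment, if_pos hX', Nat.reduceAdd] at hinc
    omega
  refine ⟨hm, h {x}, h {x, y} - h {x}, by omega, ?_, hone, ?_⟩
  · have := hpoly.submodular {x} {y}
    have hu : ({x} : Finset J) ∪ {y} = {x, y} := rfl
    rw [hu, hone y] at this
    omega
  · intro X
    rw [Nat.add_sub_cancel' h₁.le]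
    induction X using Finset.induction_on with
    | empty => simp
    | insert z Y hz ih =>
      intro hcard
      rw [Finset.card_insert_of_notMem hz] at hcard
      by_cases hY : 2 ≤ Y.card
      -- Submodularity for Y and Z ∪ {z}, which meet in the pair Z, carries g_2 = 0 over to larger
      -- sets.
      · obtain ⟨Z, hZY, hZ⟩ := Finset.exists_subset_card_eq hY
        have hzZ : z ∉ Z := fun h => hz (hZY h)
        have hsub := hpoly.submodular Y (insert z Z)
        have hinter : Y ∩ insert z Z = Z := by
          rw [Finset.inter_insert_of_notMem hz, Finset.inter_eq_right.2 hZY]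
        have hunion : Y ∪ insert z Z = insert z Y := by
          rw [Finset.union_insert, Finset.union_eq_left.2 hZY]
        rw [hinter, hunion, htwo Z hZ, ih hY] at hsub
        have h3 := hthree (insert z Z) (by rw [Finset.card_insert_of_notMem hzZ, hZ])
        have hmono := hpoly.mono Y (insert z Y) (Finset.subset_insert _ _)
        rw [ih hY] at hmono
        omega
      · exact htwo _ (by rw [Finset.card_insert_of_notMem hz]; omega)

/-- Two singletons in a compatible family force their ranks to be non-modular. -/
theorem Compatible.rank_pair_lt {J : Type*} [DecidableEq J] {h : Finset J → ℕ}
    {Δ : Set (Finset J)} (hcompat : Compatible h Δ) (hΔempty : ∅ ∉ Δ) {x y : J} (hxy : x ≠ y)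
    (hx : {x} ∈ Δ) (hy : {y} ∈ Δ) : h ∅ + h {x, y} < h {x} + h {y} := by
  -- These sets meet in {x₀}, where h' is h ∅ + 1 because ∅ ∉ Δ; this extra 1 makes the inequality
  -- strict.
  have hsub := hcompat.2 {none, some x} {none, some y}
  have hinter : ({none, some x} : Finset (Option J)) ∩ {none, some y} = {none} := by
    ext z
    simp only [Finset.mem_inter, Finset.mem_insert, Finset.mem_singleton]
    grind
  have e₀ : Finset.eraseNone ({none} : Finset (Option J)) = ∅ := by ext; simp
  have e₁ : ∀ z : J, Finset.eraseNone ({none, some z} : Finset (Option J)) = {z} := by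
    intro z; ext; simp
  have e₂ : Finset.eraseNone (({none, some x} : Finset (Option J)) ∪ {none, some y}) =
      {x, y} := by ext; simp
  have hunion : h {x, y} ≤ extensionRank h Δ ({none, some x} ∪ {none, some y}) := by
    rw [extensionRank, e₂]
    split_ifs <;> omega
  have h₀ : extensionRank h Δ {none} = h ∅ + 1 := by
    rw [extensionRank, e₀, if_pos ⟨by simp, hΔempty⟩]
  have h₁ : ∀ z, {z} ∈ Δ → extensionRank h Δ {none, some z} = h {z} := fun z hz => by
    rw [extensionRank, e₁, if_neg fun hc => hc.2 hz]
  rw [hinter, h₀, h₁ x hx, h₁ y hy] at hsub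
  omega

theorem exists_le_sum_eq {J : Type*} [Fintype J] (f : J → ℕ) (n : ℕ) (hn : n ≤ ∑ x, f x) :
    ∃ w ≤ f, ∑ x, w x = n := by
  classical
  induction n with
  | zero => exact ⟨0, fun _ => Nat.zero_le _, by simp⟩
  | succ n ih =>
    obtain ⟨w, hw, hsum⟩ := ih (by omega)
    obtain ⟨x, -, hx⟩ := Finset.exists_lt_of_sum_lt (s := Finset.univ) (f := w) (g := f) (by omega)
    refine ⟨w + Pi.single x 1, fun y => ?_, by simp [Finset.sum_add_distrib, hsum]⟩
    by_cases hy : y = x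
    · subst hy; simpa using hx
    · simpa [hy] using hw y

/-- Minimality can be dropped since the order on ℕ^J is well-founded. -/
theorem mem_accessStructure_iff_exists_bases {J P : Type*} [Fintype J] [Fintype P]
    [DecidableEq P] {Pi : J → Finset P} {h : Finset J → ℕ} {Δ : Set (Finset J)} {A : Finset P} :
    A ∈ accessStructure Pi h Δ ↔ ∃ X ∈ Δ, ∃ w ∈ bases h X, w ≤ blockVector Pi A := by
  constructor
  · rintro ⟨-, w, hw, hle⟩
    obtain ⟨X, hX, hwX⟩ := Set.mem_iUnion₂.1 hw.prop
    exact ⟨X, hX, w, hwX, hle⟩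
  · rintro ⟨X, hX, w, hwX, hle⟩
    obtain ⟨m, hmw, hm⟩ := exists_minimal_le_of_wellFoundedLT
      (fun u => u ∈ ⋃ X ∈ Δ, bases h X) w (Set.mem_iUnion₂.2 ⟨X, hX, hwX⟩)
    exact ⟨fun x => Finset.card_le_card
      (Finset.inter_subset_inter_right (Finset.subset_univ A)), m, hm, hmw.trans hle⟩

/-- A basis over {x} is a times the unit vector at x. A basis over a larger X has sum a + b and
entries at most a; conversely every such vector is a basis over J itself, which belongs to Δ. -/
theorem mem_accessStructure_iff_of_rank {J P : Type*} [Fintype J] [Fintype P] [DecidableEq P]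
    {Pi : J → Finset P} {h : Finset J → ℕ} {Δ : Set (Finset J)} {a b : ℕ}
    (hJ : 2 ≤ Fintype.card J) (h₀ : h ∅ = 0) (h₁ : ∀ x, h {x} = a)
    (h₂ : ∀ X : Finset J, 2 ≤ X.card → h X = a + b) (hΔ : IsUpperSet Δ) (hΔempty : ∅ ∉ Δ)
    (hne : Δ.Nonempty) {A : Finset P} :
    A ∈ accessStructure Pi h Δ ↔ (∃ x, {x} ∈ Δ ∧ a ≤ blockVector Pi A x) ∨
      a + b ≤ ∑ x, min (blockVector Pi A x) a := by
  classical
  rw [mem_accessStructure_iff_exists_bases]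
  constructor
  · rintro ⟨X, hX, w, ⟨hsupp, hsum, hle⟩, hwA⟩
    rcases lt_or_ge X.card 2 with hc | hc
    · have hX1 : X.card = 1 := by
        have := Finset.card_ne_zero.2 (Finset.nonempty_iff_ne_empty.2 fun h => hΔempty (h ▸ hX))
        omega
      obtain ⟨x, rfl⟩ := Finset.card_eq_one.1 hX1
      refine .inl ⟨x, hX, ?_⟩
      rw [Finset.sum_eq_single x (fun y _ hy => by_contra fun h => hy (by simpa using hsupp y h))
        (by simp), h₁] at hsum
      exact hsum ▸ hwA x
    · right
      rw [← h₂ X hc, ← hsum]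
      refine Finset.sum_le_sum fun x _ => le_min (hwA x) ?_
      by_cases hx : w x = 0
      · omega
      · simpa [h₁] using hle {x} (Finset.singleton_subset_iff.2 (hsupp x hx))
  · rintro (⟨x, hx, hxA⟩ | hsum)
    · refine ⟨{x}, hx, _root_.Pi.single x a, ⟨fun y hy => ?_, by simp [h₁], fun Y hY => ?_⟩, ?_⟩
      · by_contra hyx
        exact hy (_root_.Pi.single_eq_of_ne (by simpa using hyx) _)
      · rcases Finset.subset_singleton_iff.1 hY with rfl | rfl <;> simp [h₀, h₁]
      · intro y
        by_cases hy : y = x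
        · subst hy; simpa using hxA
        · simp [hy]
    · obtain ⟨w, hw, hws⟩ := exists_le_sum_eq _ _ hsum
      obtain ⟨X, hX⟩ := hne
      refine ⟨Finset.univ, hΔ (Finset.subset_univ X) hX, w, ⟨fun _ _ => Finset.mem_univ _, ?_, ?_⟩,
        fun x => (hw x).trans (min_le_left _ _)⟩
      · rw [hws, h₂ _ (by simpa using hJ)]
      · intro Y _
        rcases lt_or_ge Y.card 2 with hc | hc
        · rcases Nat.le_one_iff_eq_zero_or_eq_one.1 (Nat.lt_succ_iff.1 hc) with hc | hc
          · simp [Finset.card_eq_zero.1 hc]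
          · obtain ⟨x, rfl⟩ := Finset.card_eq_one.1 hc
            simpa [h₁] using (hw x).trans (min_le_right _ _)
        · rw [h₂ Y hc, ← hws]
          exact Finset.sum_le_sum_of_subset (Finset.subset_univ Y)

/-! ### Subspaces in pairwise general position -/

/-- The map `(s, t, r) ↦ s + c • t + ψ r`. -/
def pencilMap {K F G : Type*} [Field K] [AddCommGroup F] [Module K F] [AddCommGroup G]
    [Module K G] (c : K) (ψ : G →ₗ[K] F) : F × F × G →ₗ[K] F :=
  LinearMap.fst K F (F × G) + c • (LinearMap.fst K F G ∘ₗ LinearMap.snd K F (F × G)) +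
    ψ ∘ₗ LinearMap.snd K F G ∘ₗ LinearMap.snd K F (F × G)

@[simp]
theorem pencilMap_apply {K F G : Type*} [Field K] [AddCommGroup F] [Module K F] [AddCommGroup G]
    [Module K G] (c : K) (ψ : G →ₗ[K] F) (s t : F) (r : G) :
    pencilMap c ψ (s, t, r) = s + c • t + ψ r := rfl

/-- The vectors (-c t, t, 0) lie in the first kernel, and the second map sends them onto F. As ψ and
χ play no role, they remain free for the placement of e. -/
theorem ker_pencilMap_sup_ker_pencilMap {K F G : Type*} [Field K] [AddCommGroup F] [Module K F]
    [AddCommGroup G] [Module K G] {c d : K} (hcd : c ≠ d) (ψ χ : G →ₗ[K] F) :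
    LinearMap.ker (pencilMap c ψ) ⊔ LinearMap.ker (pencilMap d χ) = ⊤ := by
  rw [eq_top_iff]
  intro z _
  have hdc : d - c ≠ 0 := sub_ne_zero.2 hcd.symm
  let t : F := (d - c)⁻¹ • pencilMap d χ z
  refine Submodule.mem_sup.2 ⟨(-(c • t), t, 0), by simp, z - (-(c • t), t, 0), ?_, by abel⟩
  rw [LinearMap.mem_ker, map_sub, pencilMap_apply d χ (-(c • t)), map_zero, add_zero, neg_add_eq_sub,
    ← sub_smul, smul_inv_smul₀ hdc, sub_self]

theorem finrank_ker_pencilMap {K F G : Type*} [Field K] [AddCommGroup F] [Module K F]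
    [AddCommGroup G] [Module K G] [Module.Finite K F] [Module.Finite K G] (c : K)
    (ψ : G →ₗ[K] F) :
    Module.finrank K (LinearMap.ker (pencilMap c ψ)) = Module.finrank K F + Module.finrank K G := by
  have hsurj : LinearMap.range (pencilMap c ψ) = ⊤ :=
    LinearMap.range_eq_top.2 fun s => ⟨(s, 0, 0), by simp⟩
  have := LinearMap.finrank_range_add_finrank_ker (pencilMap c ψ)
  rw [hsurj, finrank_top, Module.finrank_prod, Module.finrank_prod] at this
  omega

/-- Over a large field there are subspaces of dimension `a` of a space of dimension `a + b`, any
two of which span the space, and a vector that lies in prescribed ones among them, provided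
that `b < a` or that it is to lie in at most one. -/
theorem exists_subspaces_sup_eq_top {K : Type} [Field K] {J : Type*} (lam : Option J ↪ K)
    (J₁ : Set J) {a b : ℕ} (hb : 1 ≤ b) (hba : b ≤ a) (hJ₁ : b < a ∨ J₁.Subsingleton) :
    ∃ (V : J → Submodule K ((Fin b → K) × (Fin b → K) × (Fin (a - b) → K)))
      (e : (Fin b → K) × (Fin b → K) × (Fin (a - b) → K)), e ≠ 0 ∧
      (∀ x, Module.finrank K (V x) = a) ∧ (∀ x y, x ≠ y → V x ⊔ V y = ⊤) ∧
      ∀ x, e ∈ V x ↔ x ∈ J₁ := by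
  classical
  have : NeZero b := ⟨by omega⟩
  suffices ∃ (ψ : J → (Fin (a - b) → K) →ₗ[K] (Fin b → K))
      (e : (Fin b → K) × (Fin b → K) × (Fin (a - b) → K)), e ≠ 0 ∧
      ∀ x, pencilMap (lam (some x)) (ψ x) e = 0 ↔ x ∈ J₁ by
    obtain ⟨ψ, e, he, hψ⟩ := this
    refine ⟨fun x => LinearMap.ker (pencilMap (lam (some x)) (ψ x)), e, he, fun x => ?_,
      fun x y hxy => ker_pencilMap_sup_ker_pencilMap (by simpa using hxy) _ _, hψ⟩
    rw [finrank_ker_pencilMap]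
    simp [hba]
  rcases hJ₁ with hlt | hsub
  · have : NeZero (a - b) := ⟨by omega⟩
    -- At e = (0, 0, 1) the pencil part s + c t vanishes, so ψ x alone decides membership.
    refine ⟨fun x => if x ∈ J₁ then 0 else (LinearMap.proj 0).smulRight 1, (0, 0, 1), ?_,
      fun x => ?_⟩
    · simp
    · by_cases hx : x ∈ J₁ <;> simp [hx]
  -- With ψ = 0, e is put into the kernel with parameter `lam o`; the spare scalar `lam none` serves
  -- an empty J₁.
  · obtain ⟨o, ho⟩ : ∃ o : Option J, ∀ x, some x = o ↔ x ∈ J₁ := by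
      rcases hsub.eq_empty_or_singleton with rfl | ⟨x, rfl⟩
      · exact ⟨none, by simp⟩
      · exact ⟨some x, by simp⟩
    refine ⟨0, (-(lam o • 1), 1, 0), by simp, fun x => ?_⟩
    rw [pencilMap_apply, map_zero, add_zero, neg_add_eq_sub, ← sub_smul, smul_eq_zero,
      or_iff_left one_ne_zero, sub_eq_zero, lam.injective.eq_iff, ho]

/-! ### Spans of vectors in general position -/

theorem finrank_span_image_le_card {K E P : Type*} [Field K] [AddCommGroup E] [Module K E]
    (u : P → E) (A : Finset P) : Module.finrank K (Submodule.span K (u '' A)) ≤ A.card := by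
  classical
  rw [← Finset.coe_image]
  exact (finrank_span_finset_le_card (R := K) (A.image u)).trans Finset.card_image_le

theorem finrank_finset_sup_le_sum {K E ι : Type*} [Field K] [AddCommGroup E] [Module K E]
    [Module.Finite K E] (s : Finset ι) (W : ι → Submodule K E) :
    Module.finrank K ↥(s.sup W) ≤ ∑ i ∈ s, Module.finrank K (W i) := by
  classical
  induction s using Finset.induction_on with
  | empty => simp
  | insert i s hi ih =>
    rw [Finset.sup_insert, Finset.sum_insert hi]
    exact (Submodule.finrank_add_le_finrank_add_finrank _ _).trans (by omega)

/-- The subspaces `0`, `V x`, `⟨e⟩` and `V x + ⟨e⟩`, with respect to which vectors are chosen in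
general position. -/
def referenceSubspace {K E J : Type*} [Field K] [AddCommGroup E] [Module K E]
    (V : J → Submodule K E) (e : E) (i : Option J × Bool) : Submodule K E :=
  i.1.elim ⊥ V ⊔ Submodule.span K (if i.2 then {e} else ∅)

theorem referenceSubspace_none_false {K E J : Type*} [Field K] [AddCommGroup E] [Module K E]
    (V : J → Submodule K E) (e : E) : referenceSubspace V e (none, false) = ⊥ := by
  simp [referenceSubspace]

section GeneralPosition

variable {K E J P : Type*} [Field K] [AddCommGroup E] [Module K E] [Module.Finite K E]
  [DecidableEq J] {V : J → Submodule K E} {e : E} {β : P → J} {u : P → E}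

/-- If the span `U` of vectors in general position is not the whole space, it is freely spanned
modulo the only `V x` that it contains (if any) by the vectors that do not belong to `V x`; and `e`
lies in `U` only if it lies in this `V x`. -/
theorem exists_finrank_span_eq (hV : ∀ x y, x ≠ y → V x ⊔ V y = ⊤)
    (huV : ∀ p, u p ∈ V (β p))
    (hu : ∀ (A : Finset P) (i : Option J × Bool),
      (∀ p ∈ A, ¬ V (β p) ≤ referenceSubspace V e i ⊔ Submodule.span K (u '' A)) →
        Module.finrank K ↥(referenceSubspace V e i ⊔ Submodule.span K (u '' A)) =
          Module.finrank K (referenceSubspace V e i) + A.card)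
    (A : Finset P) (hA : Submodule.span K (u '' A) ≠ ⊤) :
    ∃ o : Option J, o.elim ⊥ V ≤ Submodule.span K (u '' A) ∧
      Module.finrank K (Submodule.span K (u '' A)) =
        Module.finrank K ↥(o.elim ⊥ V) + (A.filter fun p => some (β p) ≠ o).card ∧
      (e ∈ Submodule.span K (u '' A) → e ∈ o.elim ⊥ V) := by
  set U := Submodule.span K (u '' A) with hU
  -- Two different V x would span the whole space, so U contains at most one.
  obtain ⟨o, hoU, ho⟩ : ∃ o : Option J, o.elim ⊥ V ≤ U ∧ ∀ y, some y ≠ o → ¬ V y ≤ U := by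
    by_cases hex : ∃ x, V x ≤ U
    · obtain ⟨x, hx⟩ := hex
      refine ⟨some x, hx, fun y hy hyU => hA (eq_top_iff.2 ?_)⟩
      rw [← hV y x (by simpa using hy)]
      exact sup_le hyU hx
    · exact ⟨none, bot_le, fun y _ hy => hex ⟨y, hy⟩⟩
  set B := A.filter fun p => some (β p) ≠ o with hB
  have hBU : Submodule.span K (u '' B) ≤ U :=
    Submodule.span_mono (Set.image_mono (Finset.coe_subset.2 (Finset.filter_subset _ _)))
  have hspan : o.elim ⊥ V ⊔ Submodule.span K (u '' B) = U := by
    refine le_antisymm (sup_le hoU hBU) (Submodule.span_le.2 ?_)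
    rintro _ ⟨p, hp, rfl⟩
    by_cases hpo : some (β p) = o
    · exact Submodule.mem_sup_left (hpo ▸ huV p)
    · exact Submodule.mem_sup_right (Submodule.subset_span ⟨p,
        Finset.mem_coe.2 (Finset.mem_filter.2 ⟨hp, hpo⟩), rfl⟩)
  have hBV : ∀ p ∈ B, ¬ V (β p) ≤ U := fun p hp => ho _ (Finset.mem_filter.1 hp).2
  have hfalse : referenceSubspace V e (o, false) = o.elim ⊥ V := by simp [referenceSubspace]
  have h₁ := hu B (o, false)
  rw [hfalse, hspan] at h₁
  refine ⟨o, hoU, h₁ hBV, fun heU => by_contra fun heo => ?_⟩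
  -- If e were in U but not in V o, adjoining e to the reference subspace would leave U unchanged,
  -- yet raise the dimension count by one.
  have htrue : referenceSubspace V e (o, true) = o.elim ⊥ V ⊔ Submodule.span K {e} := by
    simp [referenceSubspace]
  have h₂ := hu B (o, true)
  rw [htrue, sup_right_comm, hspan,
    sup_eq_left.2 ((Submodule.span_singleton_le_iff_mem _ _).2 heU),
    Submodule.finrank_sup_span_singleton heo, h₁ hBV] at h₂
  have := h₂ hBV
  omega

/-- If the span is everything, block x contributes at most min(|A_x|, a) dimensions. If it is
proper, its dimension is |A| or a + |A \ A_x|. In the latter case the bound |A| gives |A_x| ≥ a; in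
both cases the truncated sum is at most the dimension, hence below a + b. -/
theorem mem_span_iff_of_generalPosition [Fintype J] {a b : ℕ} (he : e ≠ 0)
    (hE : Module.finrank K E = a + b)
    (hVa : ∀ x, Module.finrank K (V x) = a) (hV : ∀ x y, x ≠ y → V x ⊔ V y = ⊤)
    (huV : ∀ p, u p ∈ V (β p))
    (hu : ∀ (A : Finset P) (i : Option J × Bool),
      (∀ p ∈ A, ¬ V (β p) ≤ referenceSubspace V e i ⊔ Submodule.span K (u '' A)) →
        Module.finrank K ↥(referenceSubspace V e i ⊔ Submodule.span K (u '' A)) =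
          Module.finrank K (referenceSubspace V e i) + A.card)
    (A : Finset P) :
    e ∈ Submodule.span K (u '' A) ↔
      (∃ x, e ∈ V x ∧ a ≤ (A.filter fun p => β p = x).card) ∨
        a + b ≤ ∑ x, min (A.filter fun p => β p = x).card a := by
  have hblock : ∀ x, Submodule.span K (u '' ↑(A.filter fun p => β p = x)) ≤ V x := by
    intro x
    rw [Submodule.span_le]
    rintro _ ⟨p, hp, rfl⟩
    exact (Finset.mem_filter.1 hp).2 ▸ huV p
  have hcard : A.card = ∑ x, (A.filter fun p => β p = x).card :=
    Finset.card_eq_sum_card_fiberwise fun _ _ => Finset.mem_coe.2 (Finset.mem_univ _)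
  constructor
  · intro heA
    by_cases hA : Submodule.span K (u '' A) = ⊤
    · right
      have hle : (⊤ : Submodule K E) ≤
          Finset.univ.sup fun x => Submodule.span K (u '' ↑(A.filter fun p => β p = x)) := by
        rw [← hA, Submodule.span_le]
        rintro _ ⟨p, hp, rfl⟩
        exact Finset.le_sup (f := fun x => Submodule.span K (u '' ↑(A.filter fun p => β p = x)))
          (Finset.mem_univ (β p)) (Submodule.subset_span ⟨p, by simpa using hp, rfl⟩)
      rw [← hE, ← finrank_top K E]
      refine (Submodule.finrank_mono hle).trans ((finrank_finset_sup_le_sum _ _).trans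
        (Finset.sum_le_sum fun x _ => le_min (finrank_span_image_le_card _ _) ?_))
      exact (Submodule.finrank_mono (hblock x)).trans (hVa x).le
    · left
      obtain ⟨o, -, hfin, heo⟩ := exists_finrank_span_eq hV huV hu A hA
      cases o with
      | none => exact (he (by simpa using heo heA)).elim
      | some x =>
        refine ⟨x, heo heA, ?_⟩
        have h₁ := finrank_span_image_le_card (K := K) u A
        have h₂ := Finset.card_filter_add_card_filter_not (s := A) fun p => β p = x
        rw [Option.elim_some, hVa] at hfin
        simp only [ne_eq, Option.some.injEq] at hfin
        omega
  · rintro (⟨x, hex, hx⟩ | hsum)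
    · set C := A.filter fun p => β p = x with hC
      suffices V x ≤ Submodule.span K (u '' C) from
        Submodule.span_mono (Set.image_mono (Finset.coe_subset.2 (Finset.filter_subset _ _)))
          (this hex)
      by_contra hnot
      have hfin := hu C (none, false)
      rw [referenceSubspace_none_false, bot_sup_eq, finrank_bot, zero_add] at hfin
      have := hfin fun p hp => (Finset.mem_filter.1 hp).2 ▸ hnot
      exact hnot (Submodule.eq_of_le_of_finrank_le (hblock x) (by rw [hVa, this]; exact hx)).ge
    · by_contra heA
      have hA : Submodule.span K (u '' A) ≠ ⊤ := fun h => heA (h ▸ Submodule.mem_top)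
      obtain ⟨o, -, hfin, -⟩ := exists_finrank_span_eq hV huV hu A hA
      have hlt := Submodule.finrank_lt hA
      have hle : ∀ s : Finset J, ∑ x ∈ s, min (A.filter fun p => β p = x).card a ≤
          ∑ x ∈ s, (A.filter fun p => β p = x).card := fun s =>
        Finset.sum_le_sum fun x _ => min_le_left _ _
      cases o with
      | none =>
        have := hle Finset.univ
        rw [Option.elim_none, finrank_bot, zero_add] at hfin
        simp only [ne_eq, reduceCtorEq, not_false_eq_true, Finset.filter_true] at hfin
        omega
      | some x =>
        have h₁ := hle (Finset.univ.erase x)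
        have h₂ := Finset.card_filter_add_card_filter_not (s := A) fun p => β p = x
        have h₃ := min_le_right (A.filter fun p => β p = x).card a
        rw [← Finset.add_sum_erase _ _ (Finset.mem_univ x)] at hsum hcard
        rw [Option.elim_some, hVa] at hfin
        simp only [ne_eq, Option.some.injEq] at hfin
        omega

end GeneralPosition

/-! ### The main theorem -/

theorem isIdealAccessStructure_empty {P : Type*} :
    IsIdealAccessStructure (∅ : Set (Finset P)) := by
  refine isIdeal_of_vectors (K := ZMod 2) (E := ZMod 2 × ZMod 2) (1, 0) (fun _ => (0, 1))
    (by simp) (by simp) fun A => ?_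
  have hle : Submodule.span (ZMod 2) ((fun _ : P => ((0, 1) : ZMod 2 × ZMod 2)) '' A) ≤
      LinearMap.ker (LinearMap.fst (ZMod 2) (ZMod 2) (ZMod 2)) := by
    rw [Submodule.span_le]
    rintro _ ⟨p, -, rfl⟩
    simp
  simpa using fun h => one_ne_zero (α := ZMod 2) (hle h)

theorem mainTheorem10 {J P : Type*} [Fintype J] [DecidableEq J] [Fintype P] [DecidableEq P]
    (Pi : J → Finset P) (hPi : IsPartition Pi)
    (h : Finset J → ℕ) (hpoly : IsPolymatroid h) (hunif : IsUniform h) (heta : eta h = 2)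
    (hcard : ∀ x, h {x} ≤ (Pi x).card)
    (Δ : Set (Finset J)) (hΔ : IsUpperSet Δ) (hΔempty : ∅ ∉ Δ) (hcompat : Compatible h Δ) :
    IsIdealAccessStructure (accessStructure Pi h Δ) := by
  rcases Δ.eq_empty_or_nonempty with rfl | hne
  · convert isIdealAccessStructure_empty (P := P)
    ext A
    simp [mem_accessStructure_iff_exists_bases]
  obtain ⟨hJ, a, b, hb, hba, h₁, h₂⟩ := exists_rank_of_eta_eq_two hpoly hunif heta
  choose β hβ using hPi.cover
  have hblock : ∀ (A : Finset P) x, blockVector Pi A x = (A.filter fun p => β p = x).card := by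
    intro A x
    unfold blockVector
    congr 1
    ext p
    simp only [Finset.mem_inter, Finset.mem_filter, and_congr_right_iff]
    refine fun _ => ⟨fun hp => by_contra fun hne => ?_, fun hp => hp ▸ hβ p⟩
    exact Finset.disjoint_left.1 (hPi.disjoint _ _ hne) (hβ p) hp
  -- The field must exceed the number of subspaces to be avoided and provide distinct scalars for
  -- `Option J`.
  obtain ⟨q, hq, hprime⟩ := Nat.exists_infinite_primes
    (Fintype.card (Option J × Bool) * 2 ^ Fintype.card P + Fintype.card (Option J) + 1)
  have : Fact q.Prime := ⟨hprime⟩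
  obtain ⟨lam⟩ : Nonempty (Option J ↪ ZMod q) :=
    Function.Embedding.nonempty_of_card_le (by rw [ZMod.card]; omega)
  have hJ₁ : b < a ∨ {x | {x} ∈ Δ}.Subsingleton := by
    refine or_iff_not_imp_left.2 fun hlt x hx y hy => by_contra fun hxy => hlt ?_
    have := hcompat.rank_pair_lt hΔempty hxy hx hy
    rw [h₁, h₁, h₂ _ (Finset.card_pair hxy).ge] at this
    omega
  obtain ⟨V, e, he, hVa, hV, heV⟩ := exists_subspaces_sup_eq_top lam {x | {x} ∈ Δ} hb hba hJ₁
  obtain ⟨u, huV, hu⟩ := exists_generalPosition (fun p => V (β p)) (referenceSubspace V e)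
    (by rw [ZMod.card]; omega)
  refine isIdeal_of_vectors (K := ZMod q) e u he (fun p hp => ?_) fun A => ?_
  · have hVp : V (β p) ≠ ⊥ := fun hbot => by
      have := hVa (β p)
      rw [hbot, finrank_bot] at this
      omega
    -- General position relative to 0 already makes each single vector nonzero.
    have hfin := hu {p} (none, false)
    have hspan : Submodule.span (ZMod q) (u '' ↑({p} : Finset P)) = ⊥ := by simp [hp]
    rw [referenceSubspace_none_false, bot_sup_eq, hspan, finrank_bot] at hfin
    simp [hVp] at hfin
  · rw [mem_accessStructure_iff_of_rank hJ hpoly.map_empty h₁ h₂ hΔ hΔempty hne,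
      mem_span_iff_of_generalPosition (b := b) he ?_ hVa hV huV hu A]
    · simp only [hblock, heV]
      rfl
    · simp only [Module.finrank_prod, Module.finrank_fin_fun]
      omega
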